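/- Let $X$ be a real Banach space with topological dual $X^*$. Sums and scalar multiples of subsets of $X^*$ are taken elementwise; $\operatorname{cl}^*$ is the closure in the weak$^*$ topology; $\operatorname{cone} A$ is the smallest convex cone containing $A$ and $0$, i.e. the set of all finite sums $\sum_k t_k a_k$ with $t_k \ge 0$, $a_k \in A$ (so $\operatorname{cone}\emptyset=\{0\}$); and $s(C,v)=\sup_{x^*\in C}\langle x^*,v\rangle$. For $f\colon X\to\mathbb R$ and $x, v\in X$, let $f'(x,v)=\lim_{\alpha\to+0}(f(x+\alpha v)-f(x))/\alpha$. The function $f$ is directionally differentiable (d.d.) at $x$ if this finite limit exists for all $v\in X$. It is Hadamard d.d. at $x$ if for all $v \in X$ the finite limit of $(f(x+\alpha v')-f(x))/\alpha$ as $[\alpha,v']\to[+0,v]$ exists. It is d.d. at $x$ uniformly along finite dimensional spaces if it is d.d. at $x$ and, for every $v\in X$ and every finite dimensional subspace $X_0\subset X$, $(f(x+\alpha v')-f(x))/\alpha\to f'(x,v)$ as $[\alpha,v']\to[+0,v]$ with $v'\in v+X_0$. It is quasidifferentiable at $x$ with quasidifferential $[\underline\partial f(x),\overline\partial f(x)]$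 if it is d.d. at $x$, both sets are nonempty convex weak$^*$ compact subsets of $X^*$, and $f'(x,v)=\max_{x^*\in\underline\partial f(x)}\langle x^*,v\rangle+\min_{y^*\in\overline\partial f(x)}\langle y^*,v\rangle$ for all $v\in X$. It is quasidifferentiable at $x$ uniformly along finite dimensional spaces if it is quasidifferentiable at $x$ and d.d. at $x$ uniformly along finite dimensional spaces. Below, for each function that is assumed quasidifferentiable, an arbitrary quasidifferential at $\overline x$ is fixed. Let $I=\{1,\dots,m\}$ and $J=\{1,\dots,l\}$ with $m,l\ge 0$, let $f_0,f_i,g_j\colon X\to\mathbb R$ ($i\in I$, $j\in J$), and let $\overline x$ be a locally optimal solution of the problem $$\min f_0(x)\quad\text{s.t.}\quad f_i(x)=0\ \ \forall i\in I,\qquad g_j(x)\le 0\ \ \forall j\in J.$$ Put $J(\overline x)=\{j\in J: g_j(\overline x)=0\}$. Suppose that: 1. $f_0$ is quasidifferentiable and Hadamard d.d. at $\overline x$; 2. the functions $f_i$, $i\in I$, are continuous in a neighbourhood of $\overline x$ and quasidifferentiable at $\overline x$ uniformly along finite dimensional spaces; 3. the functions $g_j$, $j\notin J(\overline x)$, are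 upper semicontinuous and quasidifferentiable at $\overline x$, and the functions $g_j$, $j\in J(\overline x)$, are quasidifferentiable at $\overline x$ uniformly along finite dimensional spaces; 4. the vectors $x_i^*\in\underline\partial f_i(\overline x)$, $y_i^*\in\overline\partial f_i(\overline x)$, $i\in I$, and $z_j^*\in\overline\partial g_j(\overline x)$, $j\in J(\overline x)$, satisfy the following constraint qualification: - (a) for every $i\in I$ there is $v_i\in X$ with $s(\underline\partial f_i(\overline x)+y_i^*,v_i)<0$ and, for all $k\in I$, $k\ne i$, $s(\underline\partial f_k(\overline x)+y_k^*,v_i)\le 0$ and $s(-x_k^*-\overline\partial f_k(\overline x),v_i)\le 0$; - (b) for every $i\in I$ there is $w_i\in X$ with $s(-x_i^*-\overline\partial f_i(\overline x),w_i)<0$ and, for all $k\in I$, $k\ne i$, $s(-x_k^*-\overline\partial f_k(\overline x),w_i)\le 0$ and $s(\underline\partial f_k(\overline x)+y_k^*,w_i)\le 0$; - (c) there is $v_0\in X$ with $s(\underline\partial g_j(\overline x)+z_j^*,v_0)<0$ for all $j\in J(\overline x)$ and, for all $i\in I$, $s(\underline\partial f_i(\overline x)+y_i^*,v_0)\le 0$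 and $s(-x_i^*-\overline\partial f_i(\overline x),v_0)\le 0$. Then for all $y_0^*\in\overline\partial f_0(\overline x)$ and all $z_j^*\in\overline\partial g_j(\overline x)$, $j\notin J(\overline x)$, there exist $\lambda_j\ge 0$, $j\in J$, such that $\lambda_j g_j(\overline x)=0$ for all $j\in J$ and $$0\in\underline\partial f_0(\overline x)+y_0^*+\sum_{j=1}^l\lambda_j\big(\underline\partial g_j(\overline x)+z_j^*\big)+\operatorname{cl}^*\operatorname{cone}\Big(\bigcup_{i\in I}C_i\Big),$$ where $C_i=(\underline\partial f_i(\overline x)+y_i^*)\cup(-x_i^*-\overline\partial f_i(\overline x))$. -/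

import Mathlib

open Set Filter Topology
open scoped Pointwise

namespace Quasidiff

section Derivatives

variable {X : Type*} [NormedAddCommGroup X] [NormedSpace ℝ X]

/-- `L` is the (finite) one-sided directional derivative of `f` at `x` in the direction `v`. -/
def HasDirDerivAt (f : X → ℝ) (x v : X) (L : ℝ) : Prop :=
  Tendsto (fun α : ℝ => (f (x + α • v) - f x) / α) (𝓝[>] 0) (𝓝 L)

/-- `f` is Hadamard directionally differentiable at `x`. -/
def HadamardDirDiffAt (f : X → ℝ) (x : X) : Prop :=
  ∀ v : X, ∃ L : ℝ,
    Tendsto (fun p : ℝ × X => (f (x + p.1 • p.2) - f x) / p.1) (𝓝[>] 0 ×ˢ 𝓝 v) (𝓝 L)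

/-- `f` is directionally differentiable at `x` uniformly along finite dimensional spaces: for every
direction `v` and every finite dimensional subspace `X₀`, the difference quotients
`(f (x + α v') - f x) / α` converge to the directional derivative `f'(x, v)` as `α → +0` and
`v' → v` with `v' ∈ v + X₀`. -/
def DirDiffUniformlyFinDimAt (f : X → ℝ) (x : X) : Prop :=
  ∀ v : X, ∃ L : ℝ, HasDirDerivAt f x v L ∧
    ∀ X₀ : Submodule ℝ X, FiniteDimensional ℝ X₀ →
      Tendsto (fun p : ℝ × X => (f (x + p.1 • p.2) - f x) / p.1)
        (𝓝[>] 0 ×ˢ 𝓝[{v} + (X₀ : Set X)] v) (𝓝 L)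

/-- `[A, B]` is a quasidifferential of `f` at `x` (with subdifferential `A` and superdifferential
`B`): `A` and `B` are convex weak* compact sets of functionals, `f` is directionally differentiable
at `x`, and `f'(x, v) = max_{a ∈ A} ⟨a, v⟩ + min_{b ∈ B} ⟨b, v⟩` for all `v`, where the maximum
and the minimum exist (so that `A` and `B` are nonempty). The topology of `WeakDual ℝ X` is the
weak* topology. -/
structure IsQuasidifferentialAt (f : X → ℝ) (x : X) (A B : Set (WeakDual ℝ X)) : Prop where
  convex_sub : Convex ℝ A
  convex_super : Convex ℝ B
  isCompact_sub : IsCompact A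
  isCompact_super : IsCompact B
  dirDeriv_eq : ∀ v : X, ∃ p q : ℝ,
    IsGreatest ((fun a : WeakDual ℝ X => a v) '' A) p ∧
    IsLeast ((fun b : WeakDual ℝ X => b v) '' B) q ∧
    HasDirDerivAt f x v (p + q)

/-- The support function `s(C, v) = sup_{c ∈ C} ⟨c, v⟩`. It is only used for nonempty weak* compact
sets `C`, for which the supremum is a maximum. -/
noncomputable def supportFun (C : Set (WeakDual ℝ X)) (v : X) : ℝ :=
  sSup ((fun c : WeakDual ℝ X => c v) '' C)

/-- The constraint qualification, for equality constraints with quasidifferentials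
`[Af i, Bf i]` and chosen elements `xs i ∈ Af i`, `ys i ∈ Bf i`, and for inequality constraints with
subdifferentials `Ag j`, chosen elements `zs j` of the superdifferentials, and set of active indices
`act`. -/
structure ConstraintQualification {m l : ℕ} (Af Bf : Fin m → Set (WeakDual ℝ X))
    (xs ys : Fin m → WeakDual ℝ X) (Ag : Fin l → Set (WeakDual ℝ X))
    (zs : Fin l → WeakDual ℝ X) (act : Set (Fin l)) : Prop where
  sub_dir : ∀ i, ∃ v : X, supportFun (Af i + {ys i}) v < 0 ∧
    ∀ k, k ≠ i → supportFun (Af k + {ys k}) v ≤ 0 ∧ supportFun ({-xs k} - Bf k) v ≤ 0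
  super_dir : ∀ i, ∃ w : X, supportFun ({-xs i} - Bf i) w < 0 ∧
    ∀ k, k ≠ i → supportFun ({-xs k} - Bf k) w ≤ 0 ∧ supportFun (Af k + {ys k}) w ≤ 0
  ineq_dir : ∃ v₀ : X, (∀ j ∈ act, supportFun (Ag j + {zs j}) v₀ < 0) ∧
    ∀ i, supportFun (Af i + {ys i}) v₀ ≤ 0 ∧ supportFun ({-xs i} - Bf i) v₀ ≤ 0

end Derivatives

section Program

variable {X : Type*}

/-- The feasible set `{x | f i x = 0 for all i, g j x ≤ 0 for all j}`. -/
def feasibleSet {m l : ℕ} (f : Fin m → X → ℝ) (g : Fin l → X → ℝ) : Set X :=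
  {x | (∀ i, f i x = 0) ∧ ∀ j, g j x ≤ 0}

/-- The set of indices of inequality constraints that are active at `x`. -/
def activeSet {l : ℕ} (g : Fin l → X → ℝ) (x : X) : Set (Fin l) :=
  {j | g j x = 0}

/-- `x` is a locally optimal solution of: minimize `f₀` subject to `f i = 0`, `g j ≤ 0`. -/
def IsLocallyOptimal [TopologicalSpace X] {m l : ℕ} (f₀ : X → ℝ) (f : Fin m → X → ℝ)
    (g : Fin l → X → ℝ) (x : X) : Prop :=
  x ∈ feasibleSet f g ∧ IsLocalMinOn f₀ (feasibleSet f g) x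

end Program

end Quasidiff

/-! Fixing one element of each superdifferential bounds the directional derivatives of the objective
and constraints from above by sublinear functions of the direction; for `-f i` the fixed element
lies in the subdifferential. `not_descent_direction` shows that no `v` makes the bounds for the
objective and the active inequalities negative and those for every `f i` and `-f i` nonpositive.
Otherwise, perturb `v` by small multiples of the qualification vectors, with weights given by a
parameter `τ` in the cube `[-1, 1]^m`, so that `f k` decreases along the perturbed direction when `τ
k = -1` and increases when `τ k = 1`. Compactness of the cube gives one step length valid for all
`τ`, and the Poincaré–Miranda theorem (`exists_eq_zero_of_sign_on_faces`) finds a `τ` at which all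
`f k` vanish: a feasible point with a smaller objective value.

Weak* separation (`exists_combination_add_mem_closure_hull`) turns this inconsistency into a Fritz
John condition. The vector `v₀` of the qualification forces the objective's multiplier to be
positive, and dividing by it gives the claim.

Poincaré–Miranda rests on Brouwer's theorem, obtained from the nonexistence of a smooth retraction
by a volume argument. -/

namespace Quasidiff

/-! ### No smooth retraction of a ball onto its sphere. -/

section NoRetraction

open MeasureTheory

/-- The map `t ↦ det (1 + t A)` is a polynomial of degree at most the dimension, so that its value
at `1` is an affine combination of its values at given nodes. -/
lemma exists_affine_combination_det {E : Type*} [NormedAddCommGroup E] [NormedSpace ℝ E]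
    [FiniteDimensional ℝ E] (v : Fin (Module.finrank ℝ E + 1) → ℝ) (hv : Function.Injective v) :
    ∃ c : Fin (Module.finrank ℝ E + 1) → ℝ, ∑ i, c i = 1 ∧
      ∀ A : E →L[ℝ] E, (1 + A).det = ∑ i, c i * (1 + v i • A).det := by
  classical
  -- Lagrange interpolation: the basis polynomials sum to `1`, and `n + 1` nodes determine a
  -- polynomial of degree at most `n`.
  refine ⟨fun i => (Lagrange.basis Finset.univ v i).eval 1, ?_, fun A => ?_⟩
  · rw [← Polynomial.eval_finsetSum, Lagrange.sum_basis hv.injOn Finset.univ_nonempty]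
    simp
  · let b := Module.finBasis ℝ E
    let M := LinearMap.toMatrix b b (A : E →ₗ[ℝ] E)
    let p : Polynomial ℝ := Matrix.det
      ((Polynomial.X : Polynomial ℝ) • M.map Polynomial.C +
        (1 : Matrix _ _ ℝ).map Polynomial.C)
    have hp : ∀ t : ℝ, p.eval t = (1 + t • A).det := by
      intro t
      have h1 : (1 + t • A).det = Matrix.det (1 + t • M) := by
        rw [ContinuousLinearMap.det, ← LinearMap.det_toMatrix b]
        congr 1
        simp [M, map_add, LinearMap.toMatrix_one]
      rw [h1]
      simp only [p]
      rw [← Polynomial.coe_evalRingHom, RingHom.map_det]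
      congr 1
      ext i j
      by_cases hij : i = j <;> simp [hij, add_comm, mul_comm t]
    have hdeg : p.degree < (Finset.univ : Finset (Fin (Module.finrank ℝ E + 1))).card := by
      refine lt_of_le_of_lt Polynomial.degree_le_natDegree ?_
      have := Polynomial.natDegree_det_X_add_C_le M 1
      rw [Fintype.card_fin] at this
      rw [Finset.card_univ, Fintype.card_fin]
      exact_mod_cast Nat.lt_succ_of_le this
    have h1 := congrArg (Polynomial.eval 1) (Lagrange.eq_interpolate hv.injOn hdeg)
    rw [hp, one_smul, Lagrange.interpolate_apply, Polynomial.eval_finsetSum] at h1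
    rw [h1]
    refine Finset.sum_congr rfl fun i _ => ?_
    rw [Polynomial.eval_mul, Polynomial.eval_C, hp, mul_comm]

variable {E : Type*} [NormedAddCommGroup E] [NormedSpace ℝ E]

/-- A Lipschitz map on a ball that vanishes on the sphere extends by zero to a Lipschitz map. -/
lemma lipschitzWith_extend_zero {g : E → E} {ρ : ℝ} {L : NNReal}
    (hL : LipschitzOnWith L g (Metric.closedBall 0 ρ)) (hg : ∀ x, ‖x‖ = ρ → g x = 0) :
    LipschitzWith L (fun x => open Classical in if ‖x‖ ≤ ρ then g x else 0) := by
  classical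
  have key : ∀ x y : E, ‖x‖ ≤ ρ → ¬ ‖y‖ ≤ ρ → ‖g x‖ ≤ L * ‖x - y‖ := by
    intro x y hx hy
    push Not at hy
    -- The segment from `x` to `y` crosses the sphere, where `g` vanishes, at a point no farther
    -- from `x` than `y` is.
    have hc : ContinuousOn (fun t : ℝ => ‖AffineMap.lineMap x y t‖) (Icc 0 1) := by fun_prop
    obtain ⟨t, ht, h⟩ := intermediate_value_Icc (zero_le_one) hc
      (show ρ ∈ Icc _ _ by simpa using ⟨hx, hy.le⟩)
    have h2 := hL.dist_le_mul x (by simpa using hx) (AffineMap.lineMap x y t)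
      (by simpa using h.le)
    rw [hg _ h, dist_zero_right, dist_left_lineMap, Real.norm_of_nonneg ht.1, dist_eq_norm] at h2
    refine h2.trans (mul_le_mul_of_nonneg_left ?_ L.2)
    exact mul_le_of_le_one_left (norm_nonneg _) ht.2
  refine LipschitzWith.of_dist_le_mul fun x y => ?_
  simp only [dist_eq_norm]
  split_ifs with hx hy hy
  · simpa [dist_eq_norm] using hL.dist_le_mul x (by simpa using hx) y (by simpa using hy)
  · simpa using key x y hx hy
  · simpa [norm_sub_rev] using key y x hy hx
  · simp; positivity

/-- Small perturbations `x + t (r x - x)` of the identity by a map `r` into the ball fixing the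
sphere pointwise map the ball bijectively onto itself. -/
lemma bijOn_closedBall [CompleteSpace E] {r : E → E} {ρ : ℝ} {L t : NNReal}
    (hL : LipschitzOnWith L (fun x => r x - x) (Metric.closedBall 0 ρ))
    (hr : ∀ x, ‖r x‖ ≤ ρ) (hr' : ∀ x, ‖x‖ = ρ → r x = x) (ht : t ≤ 1) (htL : t * L < 1) :
    BijOn (fun x => x + (t : ℝ) • (r x - x)) (Metric.closedBall 0 ρ) (Metric.closedBall 0 ρ) := by
  classical
  -- With the displacement extended by zero, preimages of `y` are the fixed points of the global
  -- contraction `x ↦ y - t • h x`.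
  have hext := lipschitzWith_extend_zero hL (fun x hx => by simp [hr' x hx])
  set h : E → E := fun x => if ‖x‖ ≤ ρ then r x - x else 0 with hh
  have hlip : ∀ y, ContractingWith (t * L) (fun x => y - (t : ℝ) • h x) := by
    intro y
    refine ⟨htL, LipschitzWith.of_dist_le_mul fun a b => ?_⟩
    rw [dist_sub_left, dist_smul₀, NNReal.coe_mul, mul_assoc]
    simpa using mul_le_mul_of_nonneg_left (hext.dist_le_mul a b) t.coe_nonneg
  have hval : ∀ x, ‖x‖ ≤ ρ → h x = r x - x := fun x hx => by simp [hh, hx]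
  refine ⟨?_, ?_, ?_⟩
  · intro x hx
    have hx : ‖x‖ ≤ ρ := by simpa using hx
    have ht' : (t : ℝ) ≤ 1 := by exact_mod_cast ht
    have : x + (t : ℝ) • (r x - x) = (1 - (t : ℝ)) • x + (t : ℝ) • r x := by module
    simp only [Metric.mem_closedBall, dist_zero_right, this]
    calc ‖(1 - (t : ℝ)) • x + (t : ℝ) • r x‖ ≤ (1 - t) * ‖x‖ + t * ‖r x‖ := by
          refine (norm_add_le _ _).trans ?_
          rw [norm_smul, norm_smul, Real.norm_of_nonneg (by linarith),
            Real.norm_of_nonneg t.coe_nonneg]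
      _ ≤ (1 - t) * ρ + t * ρ := by
          have h1 := mul_le_mul_of_nonneg_left hx (sub_nonneg.2 ht')
          have h2 := mul_le_mul_of_nonneg_left (hr x) t.coe_nonneg
          linarith
      _ = ρ := by ring
  · intro x hx y hy hxy
    have hx : ‖x‖ ≤ ρ := by simpa using hx
    have hy : ‖y‖ ≤ ρ := by simpa using hy
    simp only at hxy
    refine (hlip (x + (t : ℝ) • (r x - x))).fixedPoint_unique' ?_ ?_
    · simp [Function.IsFixedPt, hval x hx]
    · rw [Function.IsFixedPt, hval y hy, hxy]; simp
  · intro y hy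
    have hy : ‖y‖ ≤ ρ := by simpa using hy
    let x := ContractingWith.fixedPoint _ (hlip y)
    have hx : y - (t : ℝ) • h x = x := (hlip y).fixedPoint_isFixedPt
    have hxρ : ‖x‖ ≤ ρ := by
      by_contra hcon
      have : h x = 0 := by simp [hh, hcon]
      rw [this] at hx
      simp at hx
      exact hcon (hx ▸ hy)
    refine ⟨x, by simpa using hxρ, ?_⟩
    simp only
    rw [← hval x hxρ]
    nth_rewrite 1 [← hx]
    simp

/-- By the Neumann series the determinant has no zero on the path from the identity, where it equals
`1`. -/
lemma det_one_add_smul_pos [FiniteDimensional ℝ E] {A : E →L[ℝ] E} {t : ℝ}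
    (ht : 0 ≤ t) (h : t * ‖A‖ < 1) : 0 < (1 + t • A).det := by
  have hne : ∀ s ∈ Icc 0 t, (1 + s • A).det ≠ 0 := by
    intro s hs
    have : ‖s • A‖ < 1 := by
      rw [norm_smul, Real.norm_of_nonneg hs.1]
      exact (mul_le_mul_of_nonneg_right hs.2 (norm_nonneg _)).trans_lt h
    have hu : IsUnit (1 + s • A) := by
      have := isUnit_one_sub_of_norm_lt_one (x := -(s • A)) (by rwa [norm_neg])
      rwa [sub_neg_eq_add] at this
    have h2 : IsUnit ((1 + s • A : E →L[ℝ] E) : E →ₗ[ℝ] E) :=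
      hu.map (ContinuousLinearMap.toLinearMapRingHom : (E →L[ℝ] E) →+* E →ₗ[ℝ] E)
    exact ((LinearMap.isUnit_iff_isUnit_det _).1 h2).ne_zero
  have hcont : ContinuousOn (fun s : ℝ => (1 + s • A).det) (Icc 0 t) := by
    apply Continuous.continuousOn
    exact ContinuousLinearMap.continuous_det.comp (by fun_prop)
  by_contra hcon
  push Not at hcon
  obtain ⟨s, hs, h0⟩ := intermediate_value_Icc' ht hcont
    (show (0 : ℝ) ∈ Icc _ _ from ⟨hcon, by simp [ContinuousLinearMap.det]⟩)
  exact hne s hs h0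

variable [FiniteDimensional ℝ E]

/-- There is no continuously differentiable retraction of a ball onto its boundary: a smooth map
fixing the sphere has somewhere in the ball an invertible derivative. -/
lemma exists_det_fderiv_ne_zero {r : E → E} {ρ : ℝ} (hρ : 0 < ρ) (hd : ContDiff ℝ 1 r)
    (hr : ∀ x, ‖r x‖ ≤ ρ) (hr' : ∀ x, ‖x‖ = ρ → r x = x) :
    ∃ x ∈ Metric.closedBall (0 : E) ρ, (fderiv ℝ r x).det ≠ 0 := by
  have := FiniteDimensional.complete ℝ E
  borelize E
  let μ : Measure E := Measure.addHaar
  by_contra! hcon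
  set B := Metric.closedBall (0 : E) ρ with hB
  have hBc : IsCompact B := isCompact_closedBall _ _
  set g : E → E := fun x => r x - x with hg
  have hgd : ContDiff ℝ 1 g := hd.sub contDiff_id
  have hg' : Continuous (fderiv ℝ g) := hgd.continuous_fderiv (by simp)
  obtain ⟨C, hC⟩ := hBc.exists_bound_of_continuousOn hg'.continuousOn
  set L : NNReal := C.toNNReal with hLdef
  have hbound : ∀ x ∈ B, ‖fderiv ℝ g x‖ ≤ L := fun x hx =>
    (hC x hx).trans (Real.le_coe_toNNReal C)
  have hL : LipschitzOnWith L g B :=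
    (convex_closedBall _ _).lipschitzOnWith_of_nnnorm_fderiv_le
      (fun x _ => (hgd.differentiable (by simp)) x) (fun x hx => by exact_mod_cast hbound x hx)
  have hint : ∀ t : ℝ, IntegrableOn (fun x => (1 + t • fderiv ℝ g x).det) B μ := fun t =>
    (ContinuousLinearMap.continuous_det.comp (by fun_prop)).continuousOn.integrableOn_compact hBc
  -- For small `t` the perturbation is a bijection of the ball with positive Jacobian, so the change
  -- of variables formula gives the volume of the ball.
  have hvol : ∀ t : NNReal, t ≤ 1 → t * L < 1 →
      ∫ x in B, (1 + (t : ℝ) • fderiv ℝ g x).det ∂μ = μ.real B := by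
    intro t ht htL
    have hbij := bijOn_closedBall hL hr hr' ht htL
    have h1 := integral_image_eq_integral_abs_det_fderiv_smul μ
      (s := B) (f := fun x => x + (t : ℝ) • (r x - x)) (f' := fun x => 1 + (t : ℝ) • fderiv ℝ g x)
      Metric.isClosed_closedBall.measurableSet
      (fun x _ => ((hasFDerivAt_id x).add
        (((hgd.differentiable (by simp)) x).hasFDerivAt.const_smul (t : ℝ))).hasFDerivWithinAt)
      hbij.injOn (fun _ => (1 : ℝ))
    rw [hbij.image_eq] at h1
    rw [setIntegral_const, smul_eq_mul, mul_one] at h1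
    rw [h1]
    refine setIntegral_congr_fun Metric.isClosed_closedBall.measurableSet fun x hx => ?_
    have hpos : 0 < (1 + (t : ℝ) • fderiv ℝ g x).det := by
      refine det_one_add_smul_pos t.coe_nonneg
        ((mul_le_mul_of_nonneg_left (hbound x hx) t.coe_nonneg).trans_lt ?_)
      exact_mod_cast htL
    simp [abs_of_pos hpos]
  -- Distinct nodes small enough for `hvol`. Interpolation carries the volume identity to `t = 1`,
  -- where the integrand is `det r'`, assumed to vanish.
  let v : Fin (Module.finrank ℝ E + 1) → NNReal := fun i => ((i : NNReal) + 1 + L)⁻¹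
  have hv : Function.Injective (fun i => ((v i : NNReal) : ℝ)) := by
    intro i j hij
    simp only [NNReal.coe_inj, v, inv_inj, add_left_inj, Nat.cast_inj] at hij
    exact Fin.ext hij
  have hv1 : ∀ i, v i ≤ 1 := fun i => by
    refine inv_le_one_of_one_le₀ ?_
    rw [add_right_comm]; exact le_add_self
  have hvL : ∀ i, v i * L < 1 := fun i => by
    rw [inv_mul_lt_iff₀ (by positivity), mul_one]
    exact lt_add_of_pos_left _ (by positivity)
  obtain ⟨c, hc, hA⟩ := exists_affine_combination_det (E := E) _ hv
  have h0 : ∫ x in B, (1 + fderiv ℝ g x).det ∂μ = 0 := by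
    refine setIntegral_eq_zero_of_forall_eq_zero fun x hx => ?_
    have : 1 + fderiv ℝ g x = fderiv ℝ r x := by
      have h1 : HasFDerivAt g (fderiv ℝ r x - ContinuousLinearMap.id ℝ E) x :=
        ((hd.differentiable (by simp)) x).hasFDerivAt.sub (hasFDerivAt_id x)
      rw [h1.fderiv]
      exact add_sub_cancel _ _
    rw [this]; exact hcon x hx
  have h1 : ∫ x in B, (1 + fderiv ℝ g x).det ∂μ = μ.real B := by
    rw [integral_congr_ae (Eventually.of_forall fun x => hA (fderiv ℝ g x))]
    rw [integral_finsetSum _ fun i _ => (hint _).const_mul _]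
    simp_rw [integral_const_mul]
    rw [Finset.sum_congr rfl fun i _ => by rw [hvol (v i) (hv1 i) (hvL i)], ← Finset.sum_mul, hc,
      one_mul]
  have h2 : 0 < μ.real B :=
    ENNReal.toReal_pos (Metric.measure_closedBall_pos μ 0 hρ).ne' hBc.measure_lt_top.ne
  linarith

end NoRetraction

/-! ### Brouwer's fixed point theorem and the Poincaré–Miranda theorem. -/

section Brouwer

variable {E : Type*} [NormedAddCommGroup E] [InnerProductSpace ℝ E] [FiniteDimensional ℝ E]

/-- A continuous self-map of a Euclidean space that is the identity outside of a ball vanishes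
somewhere. -/
lemma exists_eq_zero_of_eq_id_outside {G : E → E} {ρ : ℝ} (hρ : 0 < ρ) (hG : Continuous G)
    (hid : ∀ x, ρ ≤ ‖x‖ → G x = x) : ∃ x, G x = 0 := by
  by_contra! hne
  -- An error below `‖G x‖` keeps the approximation nonzero, so it can be normalised to radius `ρ +
  -- 1`, the sphere on which it is the identity.
  obtain ⟨g, hg, happ, heq, -⟩ := hG.exists_contDiff_approx_and_eqOn (n := 1)
    (ε := fun x => ‖G x‖) (S := {x | ρ + 1 ≤ ‖x‖}) (U := {x | ρ < ‖x‖}) hG.norm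
    (fun x => norm_pos_iff.2 (hne x)) (isClosed_le continuous_const continuous_norm)
    ((isOpen_lt continuous_const continuous_norm).mem_nhdsSet.2
      fun x (hx : ρ + 1 ≤ ‖x‖) => show ρ < ‖x‖ by linarith)
    (contDiffOn_id.congr fun x hx => hid x (le_of_lt hx))
  have hg0 : ∀ x, g x ≠ 0 := fun x h => by simpa [h] using happ x
  let r : E → E := fun x => ((ρ + 1) * ‖g x‖⁻¹) • g x
  have hr : ContDiff ℝ 1 r :=
    (contDiff_const.mul ((hg.norm ℝ hg0).inv fun x => norm_ne_zero_iff.2 (hg0 x))).smul hg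
  have hrn : ∀ x, ‖r x‖ = ρ + 1 := fun x => by
    have := norm_ne_zero_iff.2 (hg0 x)
    simp only [r, norm_smul, norm_mul, norm_inv, norm_norm, Real.norm_of_nonneg
      (show (0 : ℝ) ≤ ρ + 1 by linarith)]
    field_simp
  obtain ⟨x, -, hx⟩ := exists_det_fderiv_ne_zero (ρ := ρ + 1) (by linarith) hr
    (fun x => (hrn x).le) (fun x hx => by
      have h1 : g x = x := (heq (show ρ + 1 ≤ ‖x‖ from hx.ge)).trans (hid x (by linarith))
      have h2 : ρ + 1 ≠ 0 := by linarith
      simp [r, h1, hx, h2])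
  have hsurj : Function.Surjective (fderiv ℝ r x) :=
    (LinearMap.equivOfDetNeZero ((fderiv ℝ r x : E →L[ℝ] E) : E →ₗ[ℝ] E) hx).surjective
  obtain ⟨v, hv⟩ := hsurj (r x)
  have hd : HasFDerivAt r (fderiv ℝ r x) x := ((hr.differentiable (by simp)) x).hasFDerivAt
  -- Since `‖r‖` is constant, the range of its derivative is orthogonal to `r x`; surjectivity puts
  -- `r x` itself in that range.
  have h1 := hd.inner ℝ hd
  have h2 : (fun t => inner ℝ (r t) (r t)) = fun _ : E => (ρ + 1) ^ 2 := by
    funext t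
    rw [real_inner_self_eq_norm_sq, hrn]
  rw [h2] at h1
  have h3 := DFunLike.congr_fun (h1.unique (hasFDerivAt_const _ x)) v
  simp [hv] at h3
  have h4 := hrn x
  rw [h3, norm_zero] at h4
  linarith

/-- Brouwer's fixed point theorem for bounded continuous maps of a Euclidean space. -/
lemma exists_fixedPoint_of_bounded {K : E → E} {M : ℝ} (hK : Continuous K)
    (hM : ∀ x, ‖K x‖ ≤ M) : ∃ x, K x = x := by
  have hM0 : 0 ≤ M := (norm_nonneg _).trans (hM 0)
  -- The cutoff is `1` up to radius `M + 1` and `0` beyond `M + 2`; any zero has norm at most `M`,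
  -- so there the cutoff is inactive.
  obtain ⟨x, hx⟩ := exists_eq_zero_of_eq_id_outside (ρ := M + 2)
    (G := fun x => x - max 0 (min 1 (M + 2 - ‖x‖)) • K x) (by linarith) (by fun_prop)
    (fun x hx => by
      rw [max_eq_left ((min_le_right _ _).trans (by linarith))]
      simp)
  have hx' := sub_eq_zero.1 hx
  have hnorm : ‖x‖ ≤ M := by
    rw [hx', norm_smul, Real.norm_of_nonneg (le_max_left _ _)]
    refine (mul_le_of_le_one_left (norm_nonneg _) ?_).trans (hM x)
    exact max_le zero_le_one (min_le_left _ _)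
  rw [min_eq_left (by linarith), max_eq_right zero_le_one, one_smul] at hx'
  exact ⟨x, hx'.symm⟩

/-- The Poincaré–Miranda theorem. -/
theorem exists_eq_zero_of_sign_on_faces {m : ℕ} {F : (Fin m → ℝ) → Fin m → ℝ}
    (hF : ContinuousOn F (Icc (-1) 1))
    (hneg : ∀ x ∈ Icc (-1 : Fin m → ℝ) 1, ∀ k, x k = -1 → F x k < 0)
    (hpos : ∀ x ∈ Icc (-1 : Fin m → ℝ) 1, ∀ k, x k = 1 → 0 < F x k) :
    ∃ x ∈ Icc (-1 : Fin m → ℝ) 1, F x = 0 := by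
  let P : (Fin m → ℝ) → Fin m → ℝ := fun x k => max (-1) (min 1 (x k))
  have hPc : Continuous P := by fun_prop
  have hP : ∀ x, P x ∈ Icc (-1 : Fin m → ℝ) 1 := fun x =>
    ⟨fun k => le_max_left _ _, fun k => max_le (by simp) (min_le_left _ _)⟩
  have hP' : ∀ x ∈ Icc (-1 : Fin m → ℝ) 1, P x = x := fun x hx => funext fun k => by
    have h1 : -1 ≤ x k := hx.1 k
    have h2 : x k ≤ 1 := hx.2 k
    simp [P, h1, h2]
  have hFP : Continuous fun x => F (P x) := hF.comp_continuous hPc hP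
  let K : EuclideanSpace ℝ (Fin m) → EuclideanSpace ℝ (Fin m) := fun x =>
    WithLp.toLp 2 (P (P x.ofLp - F (P x.ofLp)))
  have hK : Continuous K := by
    have := PiLp.continuous_ofLp 2 (fun _ : Fin m => ℝ)
    exact (PiLp.continuous_toLp 2 _).comp
      (hPc.comp ((hPc.comp this).sub (hFP.comp this)))
  obtain ⟨M, hM⟩ := (isCompact_Icc (a := (-1 : Fin m → ℝ)) (b := 1)).exists_bound_of_continuousOn
    (PiLp.continuous_toLp 2 (fun _ : Fin m => ℝ)).continuousOn
  obtain ⟨x, hx⟩ := exists_fixedPoint_of_bounded hK (fun x => hM _ (hP _))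
  have hx1 : P (P x.ofLp - F (P x.ofLp)) = x.ofLp := congrArg WithLp.ofLp hx
  have hmem : x.ofLp ∈ Icc (-1 : Fin m → ℝ) 1 := hx1 ▸ hP _
  rw [hP' _ hmem] at hx1
  refine ⟨x.ofLp, hmem, funext fun k => ?_⟩
  have hk : max (-1) (min 1 (x.ofLp k - F x.ofLp k)) = x.ofLp k := congrFun hx1 k
  have h1 := hneg _ hmem k
  have h2 := hpos _ hmem k
  simp only [Pi.zero_apply]
  -- Clipping at `1` would give `x k = 1` and `F x k ≤ 0`, against the sign on that face; likewise
  -- at `-1`. Without clipping, `F x k = 0`.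
  rcases le_total 1 (x.ofLp k - F x.ofLp k) with h | h
  · rw [min_eq_left h, max_eq_right (by norm_num)] at hk
    linarith [h2 hk.symm]
  · rw [min_eq_right h] at hk
    rcases le_total (-1) (x.ofLp k - F x.ofLp k) with h' | h'
    · rw [max_eq_right h'] at hk
      linarith
    · rw [max_eq_left h'] at hk
      linarith [h1 hk.symm]

end Brouwer

/-! ### Difference quotients, uniformly over compact families of directions. -/

section UniformLimits

variable {X : Type*} [NormedAddCommGroup X] [NormedSpace ℝ X]

/-- The limit of the difference quotients of `f` at `x` in the direction `v`, taken along
`v + X₀`, is `L`. -/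
def HasDirDerivAlongAt (f : X → ℝ) (x : X) (X₀ : Submodule ℝ X) (v : X) (L : ℝ) : Prop :=
  Tendsto (fun p : ℝ × X => (f (x + p.1 • p.2) - f x) / p.1)
    (𝓝[>] 0 ×ˢ 𝓝[{v} + (X₀ : Set X)] v) (𝓝 L)

lemma HasDirDerivAlongAt.neg {f : X → ℝ} {x v : X} {X₀ : Submodule ℝ X} {L : ℝ}
    (h : HasDirDerivAlongAt f x X₀ v L) : HasDirDerivAlongAt (-f) x X₀ v (-L) := by
  refine (Tendsto.neg h).congr fun p => ?_
  simp only [Pi.neg_apply]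
  ring

lemma DirDiffUniformlyFinDimAt.hasDirDerivAlongAt {f : X → ℝ} {x v : X} {L : ℝ}
    (h : DirDiffUniformlyFinDimAt f x) (hL : HasDirDerivAt f x v L) (X₀ : Submodule ℝ X)
    [FiniteDimensional ℝ X₀] : HasDirDerivAlongAt f x X₀ v L := by
  obtain ⟨L', h1, h2⟩ := h v
  rw [tendsto_nhds_unique hL h1]
  exact h2 X₀ inferInstance

lemma HadamardDirDiffAt.hasDirDerivAlongAt {f : X → ℝ} {x v : X} {L : ℝ}
    (h : HadamardDirDiffAt f x) (hL : HasDirDerivAt f x v L) (X₀ : Submodule ℝ X) :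
    HasDirDerivAlongAt f x X₀ v L := by
  obtain ⟨L', h1⟩ := h v
  have hc : Tendsto (fun α : ℝ => (α, v)) (𝓝[>] 0) (𝓝[>] 0 ×ˢ 𝓝 v) :=
    tendsto_id.prodMk tendsto_const_nhds
  have h2 : HasDirDerivAt f x v L' := by
    unfold HasDirDerivAt
    exact (h1.comp hc).congr fun α => rfl
  rw [tendsto_nhds_unique hL h2]
  have hle : 𝓝[>] (0 : ℝ) ×ˢ 𝓝[{v} + (X₀ : Set X)] v ≤ 𝓝[>] 0 ×ˢ 𝓝 v :=
    Filter.prod_mono le_rfl nhdsWithin_le_nhds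
  exact Tendsto.mono_left h1 hle

/-- A local property that holds near every point of a compact set holds uniformly on it. -/
lemma eventually_forall_mem_of_isCompact {Y : Type*} [TopologicalSpace Y] {T : Set Y}
    (hT : IsCompact T) {l : Filter ℝ} {P : ℝ → Y → Prop}
    (h : ∀ y ∈ T, ∀ᶠ p in l ×ˢ 𝓝[T] y, P p.1 p.2) : ∀ᶠ α in l, ∀ y ∈ T, P α y := by
  refine hT.induction_on (p := fun S => ∀ᶠ α in l, ∀ y ∈ S, P α y) (by simp) ?_ ?_ ?_
  · exact fun s t hst ht => ht.mono fun α hα y hy => hα y (hst hy)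
  · intro s t hs ht
    filter_upwards [hs, ht] with α h1 h2 y hy
    exact hy.elim (h1 y) (h2 y)
  · intro y hy
    obtain ⟨A, hA, B, hB, hAB⟩ := mem_prod_iff.1 (h y hy)
    refine ⟨B, hB, ?_⟩
    filter_upwards [hA] with α hα y' hy'
    exact hAB (mk_mem_prod hα hy')

/-- If the directional derivatives are negative along a compact finite dimensional family of
directions, then a small step decreases the function, uniformly over the family. -/
lemma eventually_forall_lt_of_dirDeriv_neg {Y : Type*} [TopologicalSpace Y] {T : Set Y}
    (hT : IsCompact T) {u : Y → X} (hu : ContinuousOn u T) {X₀ : Submodule ℝ X}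
    (hX₀ : ∀ y ∈ T, ∀ y' ∈ T, u y' - u y ∈ X₀) {f : X → ℝ} {x : X}
    (h : ∀ y ∈ T, ∃ L < 0, HasDirDerivAlongAt f x X₀ (u y) L) :
    ∀ᶠ α : ℝ in 𝓝[>] 0, ∀ y ∈ T, f (x + α • u y) < f x := by
  refine eventually_forall_mem_of_isCompact hT fun y hy => ?_
  obtain ⟨L, hL0, hL⟩ := h y hy
  have hu' : Tendsto u (𝓝[T] y) (𝓝[{u y} + (X₀ : Set X)] (u y)) :=
    tendsto_nhdsWithin_iff.2 ⟨hu y hy, by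
      filter_upwards [self_mem_nhdsWithin] with y' hy'
      exact ⟨u y, rfl, u y' - u y, hX₀ y hy y' hy', add_sub_cancel _ _⟩⟩
  have h1 : Tendsto (fun p : ℝ × Y => (p.1, u p.2)) (𝓝[>] 0 ×ˢ 𝓝[T] y)
      (𝓝[>] 0 ×ˢ 𝓝[{u y} + (X₀ : Set X)] (u y)) := tendsto_id.prodMap hu'
  have h2 : ∀ᶠ p in 𝓝[>] (0 : ℝ) ×ˢ 𝓝[T] y, (0 : ℝ) < p.1 :=
    tendsto_fst.eventually self_mem_nhdsWithin
  filter_upwards [(hL.comp h1).eventually (gt_mem_nhds hL0), h2] with p hp hp0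
  simp only [Function.comp] at hp
  rw [div_lt_iff₀ hp0, zero_mul] at hp
  linarith

lemma eventually_forall_mem_of_mem_nhds {Y : Type*} [TopologicalSpace Y] {T : Set Y}
    (hT : IsCompact T) {u : Y → X} (hu : ContinuousOn u T) {x : X} {N : Set X} (hN : N ∈ 𝓝 x) :
    ∀ᶠ α : ℝ in 𝓝[>] 0, ∀ y ∈ T, x + α • u y ∈ N := by
  refine eventually_forall_mem_of_isCompact hT fun y hy => ?_
  have h1 : Tendsto (fun p : ℝ × Y => x + p.1 • u p.2) (𝓝[>] 0 ×ˢ 𝓝[T] y)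
      (𝓝 (x + (0 : ℝ) • u y)) :=
    tendsto_const_nhds.add (((tendsto_id.mono_left nhdsWithin_le_nhds).comp tendsto_fst).smul
      ((hu y hy).tendsto.comp tendsto_snd))
  rw [zero_smul, add_zero] at h1
  exact h1 hN

end UniformLimits

/-! ### Sublinear bounds from quasidifferentials. -/

section Quasidifferentials

variable {X : Type*} [NormedAddCommGroup X] [NormedSpace ℝ X]

namespace IsQuasidifferentialAt

variable {f : X → ℝ} {x : X} {A B : Set (WeakDual ℝ X)}

lemma nonempty_sub (h : IsQuasidifferentialAt f x A B) : A.Nonempty := by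
  obtain ⟨p, q, hp, -, -⟩ := h.dirDeriv_eq 0
  exact hp.1.imp fun a ha => ha.1

/-- The directional derivative is bounded above by any `a + b` with a suitable `a ∈ A` and bounded
below by any `a + b` with a suitable `b ∈ B`. -/
lemma exists_hasDirDerivAt (h : IsQuasidifferentialAt f x A B) (v : X) :
    ∃ L, HasDirDerivAt f x v L ∧ (∃ a ∈ A, ∀ b ∈ B, L ≤ a v + b v) ∧
      ∃ b ∈ B, ∀ a ∈ A, a v + b v ≤ L := by
  obtain ⟨p, q, ⟨⟨a, ha, rfl⟩, hp⟩, ⟨⟨b, hb, rfl⟩, hq⟩, hL⟩ := h.dirDeriv_eq v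
  exact ⟨_, hL, ⟨a, ha, fun b' hb' => add_le_add_right (hq ⟨b', hb', rfl⟩) _⟩,
    b, hb, fun a' ha' => add_le_add_left (hp ⟨a', ha', rfl⟩) _⟩

end IsQuasidifferentialAt

/-- Weak* compactness bounds the values, so that `sSup` is a true supremum. -/
lemma apply_le_supportFun {C : Set (WeakDual ℝ X)} (hC : IsCompact C) {c : WeakDual ℝ X}
    (hc : c ∈ C) (v : X) : c v ≤ supportFun C v :=
  le_csSup (hC.image (WeakDual.eval_continuous v)).bddAbove ⟨c, hc, rfl⟩

lemma add_apply_le_supportFun {A : Set (WeakDual ℝ X)} (hA : IsCompact A) {a : WeakDual ℝ X}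
    (ha : a ∈ A) (y : WeakDual ℝ X) (v : X) : a v + y v ≤ supportFun (A + {y}) v :=
  apply_le_supportFun (hA.add isCompact_singleton) (add_mem_add ha rfl) v

lemma neg_sub_apply_le_supportFun {B : Set (WeakDual ℝ X)} (hB : IsCompact B) {b : WeakDual ℝ X}
    (hb : b ∈ B) (y : WeakDual ℝ X) (v : X) : -y v - b v ≤ supportFun ({-y} - B) v := by
  refine apply_le_supportFun (c := -y - b) ?_ (sub_mem_sub (mem_singleton _) hb) v
  rw [sub_eq_add_neg]
  exact isCompact_singleton.add hB.neg

/-- Strict negativity of a weak* compact set of functionals at a point persists, uniformly, along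
small steps in a compact finite dimensional set of directions. -/
lemma eventually_forall_apply_add_smul_neg {ι : Type*} [Fintype ι] {A : Set (WeakDual ℝ X)}
    (hA : IsCompact A) (y : WeakDual ℝ X) {v : X} (hv : ∀ a ∈ A, a v + y v < 0) (e : ι → X)
    {T : Set (ι → ℝ)} (hT : IsCompact T) :
    ∀ᶠ ε : ℝ in 𝓝[>] 0, ∀ t ∈ T, ∀ a ∈ A,
      a (v + ε • ∑ i, t i • e i) + y (v + ε • ∑ i, t i • e i) < 0 := by
  -- Expanding by linearity leaves only evaluations at the fixed vectors `v` and `e i`, which are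
  -- weak* continuous; this yields joint continuity.
  have hc : Continuous fun p : ℝ × (ι → ℝ) × WeakDual ℝ X =>
      p.2.2 (v + p.1 • ∑ i, p.2.1 i • e i) + y (v + p.1 • ∑ i, p.2.1 i • e i) := by
    have he : ∀ w : X, Continuous fun p : ℝ × (ι → ℝ) × WeakDual ℝ X => p.2.2 w := fun w =>
      (WeakDual.eval_continuous w).comp (continuous_snd.comp continuous_snd)
    have ht : ∀ i, Continuous fun p : ℝ × (ι → ℝ) × WeakDual ℝ X => p.2.1 i := fun i =>
      (continuous_apply i).comp (continuous_fst.comp continuous_snd)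
    simp only [map_add, map_smul, map_sum, smul_eq_mul]
    exact ((he v).add (continuous_fst.mul (continuous_finsetSum _ fun i _ =>
      (ht i).mul (he (e i))))).add (continuous_const.add (continuous_fst.mul
        (continuous_finsetSum _ fun i _ => (ht i).mul continuous_const)))
  have := (hT.prod hA).eventually_forall_of_forall_eventually (x₀ := (0 : ℝ))
    (P := fun ε p => p.2 (v + ε • ∑ i, p.1 i • e i) + y (v + ε • ∑ i, p.1 i • e i) < 0)
    fun p hp => hc.continuousAt.eventually (gt_mem_nhds (by simpa using hv _ hp.2))
  filter_upwards [this.filter_mono nhdsWithin_le_nhds] with ε hε t ht a ha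
  exact hε (t, a) ⟨ht, ha⟩

end Quasidifferentials

/-! ### Correcting a descent direction to restore feasibility. -/

section Descent

variable {X : Type*} [NormedAddCommGroup X] [NormedSpace ℝ X]

/-- The weights of the positive and negative parts of the coordinates of `τ`. -/
def signWeights {m : ℕ} (τ : Fin m → ℝ) : Fin m ⊕ Fin m → ℝ :=
  Sum.elim (fun i => max (-τ i) 0) fun i => max (τ i) 0

lemma signWeights_nonneg {m : ℕ} (τ : Fin m → ℝ) (i : Fin m ⊕ Fin m) : 0 ≤ signWeights τ i := by
  cases i <;> exact le_max_right _ _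

lemma signWeights_mem {m : ℕ} {τ : Fin m → ℝ} (hτ : τ ∈ Icc (-1) 1) :
    signWeights τ ∈ Icc (0 : Fin m ⊕ Fin m → ℝ) 1 := by
  refine ⟨fun i => signWeights_nonneg τ i, fun i => ?_⟩
  rcases i with i | i
  · have : -1 ≤ τ i := hτ.1 i
    exact max_le (by simp; linarith) (by simp)
  · exact max_le (hτ.2 i) (by simp)

lemma continuous_signWeights {m : ℕ} : Continuous (signWeights (m := m)) := by
  refine continuous_pi fun i => ?_
  rcases i with i | i <;> simp only [signWeights, Sum.elim_inl, Sum.elim_inr] <;> fun_prop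

/-- An affine combination of functional values that are nonpositive, with one negative value of
positive weight, is negative. -/
lemma add_smul_sum_neg {ι : Type*} [Fintype ι] {c : WeakDual ℝ X} {v : X} {e : ι → X} {t : ι → ℝ}
    {ε : ℝ} (hε : 0 < ε) (ht : ∀ i, 0 ≤ t i) (hv : c v ≤ 0) {k : ι} (hk : c (e k) < 0)
    (hkt : 0 < t k) (h : ∀ i, i ≠ k → t i ≠ 0 → c (e i) ≤ 0) :
    c (v + ε • ∑ i, t i • e i) < 0 := by
  rw [map_add, map_smul, map_sum, smul_eq_mul]
  have : ∑ i, c (t i • e i) < 0 := by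
    refine Finset.sum_neg' (fun i _ => ?_) ⟨k, Finset.mem_univ _, ?_⟩
    · rw [map_smul, smul_eq_mul]
      by_cases hik : i = k
      · exact hik ▸ (mul_neg_of_pos_of_neg hkt hk).le
      · by_cases hti : t i = 0
        · simp [hti]
        · exact mul_nonpos_of_nonneg_of_nonpos (ht i) (h i hik hti)
    · rw [map_smul, smul_eq_mul]
      exact mul_neg_of_pos_of_neg hkt hk
  have := mul_neg_of_pos_of_neg hε this
  linarith

/-- At a locally optimal solution there is no direction along which the upper convex approximations
of the objective and the active inequality constraints are negative while those of the equality
constraints and of their negatives are nonpositive. -/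
theorem not_descent_direction {m l : ℕ} {f₀ : X → ℝ} {f : Fin m → X → ℝ} {g : Fin l → X → ℝ}
    {xbar : X} {A₀ B₀ : Set (WeakDual ℝ X)} {Af Bf : Fin m → Set (WeakDual ℝ X)}
    {Ag Bg : Fin l → Set (WeakDual ℝ X)}
    (hopt : IsLocallyOptimal f₀ f g xbar)
    (hf₀_qd : IsQuasidifferentialAt f₀ xbar A₀ B₀)
    (hf₀_had : HadamardDirDiffAt f₀ xbar)
    (hf_cont : ∀ i, ∃ U ∈ 𝓝 xbar, ContinuousOn (f i) U)
    (hf_qd : ∀ i, IsQuasidifferentialAt (f i) xbar (Af i) (Bf i))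
    (hf_unif : ∀ i, DirDiffUniformlyFinDimAt (f i) xbar)
    (hg_usc : ∀ j, j ∉ activeSet g xbar → UpperSemicontinuousAt (g j) xbar)
    (hg_qd : ∀ j, IsQuasidifferentialAt (g j) xbar (Ag j) (Bg j))
    (hg_unif : ∀ j ∈ activeSet g xbar, DirDiffUniformlyFinDimAt (g j) xbar)
    {xs ys : Fin m → WeakDual ℝ X} {zs : Fin l → WeakDual ℝ X}
    (hxs : ∀ i, xs i ∈ Af i) (hys : ∀ i, ys i ∈ Bf i)
    (hzs : ∀ j ∈ activeSet g xbar, zs j ∈ Bg j)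
    (hCQ : ConstraintQualification Af Bf xs ys Ag zs (activeSet g xbar))
    {y₀ : WeakDual ℝ X} (hy₀ : y₀ ∈ B₀) {v : X}
    (hv₀ : ∀ a ∈ A₀, a v + y₀ v < 0)
    (hvg : ∀ j ∈ activeSet g xbar, ∀ a ∈ Ag j, a v + zs j v < 0)
    (hvA : ∀ k, ∀ a ∈ Af k, a v + ys k v ≤ 0)
    (hvB : ∀ k, ∀ b ∈ Bf k, -xs k v - b v ≤ 0) : False := by
  choose V hV hV' using hCQ.sub_dir
  choose W hW hW' using hCQ.super_dir
  let e : Fin m ⊕ Fin m → X := Sum.elim V W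
  let T : Set (Fin m → ℝ) := Icc (-1) 1
  have hT : IsCompact T := isCompact_Icc
  -- a step size that keeps the strict inequalities
  have hstep : ∀ᶠ ε : ℝ in 𝓝[>] 0, 0 < ε ∧
      (∀ t ∈ Icc (0 : Fin m ⊕ Fin m → ℝ) 1, ∀ a ∈ A₀,
        a (v + ε • ∑ i, t i • e i) + y₀ (v + ε • ∑ i, t i • e i) < 0) ∧
      ∀ j : Fin l, j ∈ activeSet g xbar → ∀ t ∈ Icc (0 : Fin m ⊕ Fin m → ℝ) 1, ∀ a ∈ Ag j,
        a (v + ε • ∑ i, t i • e i) + zs j (v + ε • ∑ i, t i • e i) < 0 := by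
    refine (eventually_mem_nhdsWithin).and
      ((eventually_forall_apply_add_smul_neg hf₀_qd.isCompact_sub y₀ hv₀ e isCompact_Icc).and ?_)
    refine eventually_all.2 fun j => ?_
    by_cases hj : j ∈ activeSet g xbar
    · filter_upwards [eventually_forall_apply_add_smul_neg (hg_qd j).isCompact_sub (zs j)
        (hvg j hj) e isCompact_Icc] with ε h _ using h
    · exact Eventually.of_forall fun _ h => absurd h hj
  obtain ⟨ε, hε, hε₀, hεg⟩ := hstep.exists
  -- Negative coordinates of `τ` activate `V i`, which lowers `f i`; positive ones activate `W i`,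
  -- which raises it. All differences of these directions lie in the span of the finite family `e`.
  let u : (Fin m → ℝ) → X := fun τ => v + ε • ∑ i, signWeights τ i • e i
  have hu : Continuous u := by
    refine continuous_const.add (continuous_const.smul (continuous_finsetSum _ fun i _ => ?_))
    exact ((continuous_apply i).comp continuous_signWeights).smul continuous_const
  let X₀ : Submodule ℝ X := Submodule.span ℝ (range e)
  have : FiniteDimensional ℝ X₀ := FiniteDimensional.span_of_finite ℝ (finite_range e)
  have hX₀ : ∀ τ τ', u τ' - u τ ∈ X₀ := fun τ τ' => by
    have hmem : ∀ τ, ε • ∑ i, signWeights τ i • e i ∈ X₀ := fun τ =>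
      X₀.smul_mem _ (X₀.sum_mem fun i _ => X₀.smul_mem _ (Submodule.subset_span ⟨i, rfl⟩))
    simpa only [u, add_sub_add_left_eq_sub] using X₀.sub_mem (hmem τ') (hmem τ)
  -- the objective decreases
  have h₀ : ∀ᶠ α : ℝ in 𝓝[>] 0, ∀ τ ∈ T, f₀ (xbar + α • u τ) < f₀ xbar := by
    refine eventually_forall_lt_of_dirDeriv_neg hT hu.continuousOn
      (fun τ _ τ' _ => hX₀ τ τ') fun τ hτ => ?_
    obtain ⟨L, hL, ⟨a, ha, hab⟩, -⟩ := hf₀_qd.exists_hasDirDerivAt (u τ)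
    exact ⟨L, (hab y₀ hy₀).trans_lt (hε₀ _ (signWeights_mem hτ) a ha),
      hf₀_had.hasDirDerivAlongAt hL X₀⟩
  -- the inequality constraints hold
  have hg : ∀ j, ∀ᶠ α : ℝ in 𝓝[>] 0, ∀ τ ∈ T, g j (xbar + α • u τ) ≤ 0 := by
    intro j
    by_cases hj : j ∈ activeSet g xbar
    · have : ∀ᶠ α : ℝ in 𝓝[>] 0, ∀ τ ∈ T, g j (xbar + α • u τ) < g j xbar := by
        refine eventually_forall_lt_of_dirDeriv_neg hT hu.continuousOn
          (fun τ _ τ' _ => hX₀ τ τ') fun τ hτ => ?_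
        obtain ⟨L, hL, ⟨a, ha, hab⟩, -⟩ := (hg_qd j).exists_hasDirDerivAt (u τ)
        exact ⟨L, (hab _ (hzs j hj)).trans_lt (hεg j hj _ (signWeights_mem hτ) a ha),
          (hg_unif j hj).hasDirDerivAlongAt hL X₀⟩
      filter_upwards [this] with α h τ hτ
      exact (h τ hτ).le.trans_eq hj
    · have hneg : g j xbar < 0 := lt_of_le_of_ne (hopt.1.2 j) hj
      filter_upwards [eventually_forall_mem_of_mem_nhds hT hu.continuousOn
        (hg_usc j hj 0 hneg)] with α h τ hτ
      exact (h τ hτ).le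
  -- signs of the equality constraints on the faces
  have hneg : ∀ k, ∀ᶠ α : ℝ in 𝓝[>] 0, ∀ τ ∈ T ∩ {τ | τ k = -1}, f k (xbar + α • u τ) < 0 := by
    intro k
    have hTk : IsCompact (T ∩ {τ | τ k = -1}) :=
      hT.inter_right (isClosed_eq (continuous_apply k) continuous_const)
    have := eventually_forall_lt_of_dirDeriv_neg (f := f k) (x := xbar) hTk hu.continuousOn
      (fun τ _ τ' _ => hX₀ τ τ') fun τ hτ => by
        obtain ⟨L, hL, ⟨a, ha, hab⟩, -⟩ := (hf_qd k).exists_hasDirDerivAt (u τ)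
        refine ⟨L, (hab _ (hys k)).trans_lt ?_, (hf_unif k).hasDirDerivAlongAt hL X₀⟩
        have hτk : τ k = -1 := hτ.2
        have hle := fun w => add_apply_le_supportFun (hf_qd k).isCompact_sub ha (ys k) w
        -- On this face `V k` has weight `1` and `W k` has weight `0`. The latter matters because
        -- the qualification does not bound `a + ys k` at `W k`.
        refine add_smul_sum_neg (c := a + ys k) (k := Sum.inl k) hε (signWeights_nonneg τ)
          (hvA k a ha) ((hle _).trans_lt (hV k)) (by simp [signWeights, hτk]) ?_
        rintro (i | i) hi hti
        · have hik : k ≠ i := fun h => hi (h ▸ rfl)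
          exact (hle _).trans (hV' i k hik).1
        · have hik : k ≠ i := by
            rintro rfl
            simp [signWeights, hτk] at hti
          exact (hle _).trans (hW' i k hik).2
    filter_upwards [this] with α h τ hτ
    exact (h τ hτ).trans_eq (hopt.1.1 k)
  have hpos : ∀ k, ∀ᶠ α : ℝ in 𝓝[>] 0, ∀ τ ∈ T ∩ {τ | τ k = 1}, 0 < f k (xbar + α • u τ) := by
    intro k
    have hTk : IsCompact (T ∩ {τ | τ k = 1}) :=
      hT.inter_right (isClosed_eq (continuous_apply k) continuous_const)
    have := eventually_forall_lt_of_dirDeriv_neg (f := -f k) (x := xbar) hTk hu.continuousOn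
      (fun τ _ τ' _ => hX₀ τ τ') fun τ hτ => by
        -- For `-f k` the lower bound is used: the minimising `b` gives `-L ≤ -xs k (u τ) - b (u
        -- τ)`.
        obtain ⟨L, hL, -, b, hb, hab⟩ := (hf_qd k).exists_hasDirDerivAt (u τ)
        refine ⟨-L, lt_of_le_of_lt (b := -xs k (u τ) - b (u τ)) ?_ ?_,
          ((hf_unif k).hasDirDerivAlongAt hL X₀).neg⟩
        · linarith [hab _ (hxs k)]
        have hτk : τ k = 1 := hτ.2
        have hle := fun w => neg_sub_apply_le_supportFun (hf_qd k).isCompact_super hb (xs k) w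
        refine add_smul_sum_neg (c := -xs k - b) (k := Sum.inr k) hε (signWeights_nonneg τ)
          (hvB k b hb) ((hle _).trans_lt (hW k)) (by simp [signWeights, hτk]) ?_
        rintro (i | i) hi hti
        · have hik : k ≠ i := by
            rintro rfl
            simp [signWeights, hτk] at hti
          exact (hle _).trans (hV' i k hik).2
        · have hik : k ≠ i := fun h => hi (h ▸ rfl)
          exact (hle _).trans (hW' i k hik).1
    filter_upwards [this] with α h τ hτ
    have h1 := h τ hτ
    rw [Pi.neg_apply, Pi.neg_apply, hopt.1.1 k] at h1
    linarith
  -- a feasible point with a smaller value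
  choose U hU hUc using hf_cont
  have hmin : {x | x ∈ feasibleSet f g → f₀ xbar ≤ f₀ x} ∈ 𝓝 xbar :=
    eventually_nhdsWithin_iff.1 hopt.2
  have hall := h₀.and ((eventually_all.2 hg).and ((eventually_all.2 hneg).and
    ((eventually_all.2 hpos).and ((eventually_all.2 fun k =>
      eventually_forall_mem_of_mem_nhds hT hu.continuousOn (hU k)).and
      (eventually_forall_mem_of_mem_nhds hT hu.continuousOn hmin)))))
  obtain ⟨α, hα₀, hαg, hαn, hαp, hαU, hαmin⟩ := hall.exists
  obtain ⟨τ, hτ, hzero⟩ := exists_eq_zero_of_sign_on_faces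
    (F := fun τ k => f k (xbar + α • u τ))
    (continuousOn_pi.2 fun k => (hUc k).comp (by fun_prop) fun τ hτ => hαU k τ hτ)
    (fun τ hτ k hk => hαn k τ ⟨hτ, hk⟩) (fun τ hτ k hk => hαp k τ ⟨hτ, hk⟩)
  exact (hα₀ τ hτ).not_ge (hαmin τ hτ ⟨fun k => congrFun hzero k, fun j => hαg j τ hτ⟩)

end Descent

/-! ### Weak* separation and a theorem of the alternative. -/

section Separation

/-- The set of all convex combinations of choices from finitely many sets. -/
def convexCombinations {ι W : Type*} [Fintype ι] [AddCommGroup W] [Module ℝ W]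
    (S : ι → Set W) : Set W :=
  (fun p : (ι → ℝ) × (ι → W) => ∑ i, p.1 i • p.2 i) '' (stdSimplex ℝ ι ×ˢ univ.pi S)

lemma convex_convexCombinations {ι W : Type*} [Fintype ι] [AddCommGroup W] [Module ℝ W]
    {S : ι → Set W} (hS : ∀ i, Convex ℝ (S i)) : Convex ℝ (convexCombinations S) := by
  rintro _ ⟨⟨μ, a⟩, ⟨hμ, ha⟩, rfl⟩ _ ⟨⟨ν, b⟩, ⟨hν, hb⟩, rfl⟩ s t hs ht hst
  have h : ∀ i, ∃ c ∈ S i, (s * μ i + t * ν i) • c = (s * μ i) • a i + (t * ν i) • b i :=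
    fun i => (hS i).exists_mem_add_smul_eq (ha i trivial) (hb i trivial)
      (mul_nonneg hs (hμ.1 i)) (mul_nonneg ht (hν.1 i))
  choose c hc hc' using h
  refine ⟨(s • μ + t • ν, c), ⟨convex_stdSimplex ℝ ι hμ hν hs ht hst, fun i _ => hc i⟩, ?_⟩
  simp only [Pi.add_apply, Pi.smul_apply, smul_eq_mul, hc', Finset.sum_add_distrib,
    Finset.smul_sum, mul_smul]

lemma isCompact_convexCombinations {ι W : Type*} [Fintype ι] [AddCommGroup W] [Module ℝ W]
    [TopologicalSpace W] [ContinuousAdd W] [ContinuousSMul ℝ W] {S : ι → Set W}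
    (hS : ∀ i, IsCompact (S i)) : IsCompact (convexCombinations S) :=
  ((isCompact_stdSimplex ℝ ι).prod (isCompact_univ_pi hS)).image (by fun_prop)

lemma single_mem_convexCombinations {ι W : Type*} [Fintype ι] [AddCommGroup W] [Module ℝ W]
    {S : ι → Set W} (hS : ∀ i, (S i).Nonempty) {i : ι} {a : W} (ha : a ∈ S i) :
    a ∈ convexCombinations S := by
  classical
  choose b hb using hS
  refine ⟨(Pi.single i 1, Function.update b i a), ⟨single_mem_stdSimplex ℝ i, fun j _ => ?_⟩, ?_⟩
  · by_cases h : j = i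
    · subst h; simpa using ha
    · simpa [h] using hb j
  · simp [Pi.single_apply]

variable {X : Type*} [NormedAddCommGroup X] [NormedSpace ℝ X]

/-- Disjoint convex sets of functionals, one weak* compact and the other weak* closed, are strictly
separated by a vector. -/
lemma exists_separating_vector {D K : Set (WeakDual ℝ X)} (hD : Convex ℝ D) (hDc : IsCompact D)
    (hK : Convex ℝ K) (hKc : IsClosed K) (h : Disjoint D K) :
    ∃ (v : X) (s t : ℝ), (∀ a ∈ D, a v < s) ∧ s < t ∧ ∀ b ∈ K, t < b v := by
  have : LocallyConvexSpace ℝ (WeakDual ℝ X) :=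
    WeakBilin.locallyConvexSpace (B := topDualPairing ℝ X)
  obtain ⟨φ, s, t, h1, h2, h3⟩ := geometric_hahn_banach_compact_closed hD hDc hK hKc h
  -- Weak* continuous functionals are evaluations, so the separating functional comes from `X`
  -- itself.
  obtain ⟨v, rfl⟩ := LinearMap.dualEmbedding_surjective (topDualPairing ℝ X) φ
  exact ⟨v, s, t, h1, h2, h3⟩

/-- A theorem of the alternative: if no vector is negative on finitely many weak* compact convex
sets and nonpositive on `C`, then a convex combination of elements of these sets belongs to the
negative of the weak* closed convex cone generated by `C`. -/
lemma exists_combination_add_mem_closure_hull {ι : Type*} [Fintype ι]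
    {S : ι → Set (WeakDual ℝ X)} (hconv : ∀ i, Convex ℝ (S i)) (hcomp : ∀ i, IsCompact (S i))
    (hne : ∀ i, (S i).Nonempty) (C : Set (WeakDual ℝ X))
    (h : ∀ v : X, (∀ i, ∀ a ∈ S i, a v < 0) → (∀ c ∈ C, c v ≤ 0) → False) :
    ∃ μ ∈ stdSimplex ℝ ι, ∃ a : ι → WeakDual ℝ X, (∀ i, a i ∈ S i) ∧
      ∃ c ∈ closure (PointedCone.hull ℝ C : Set (WeakDual ℝ X)), ∑ i, μ i • a i + c = 0 := by
  set H : PointedCone ℝ (WeakDual ℝ X) := PointedCone.hull ℝ C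
  by_cases hdisj : Disjoint (convexCombinations S) (-closure (H : Set (WeakDual ℝ X)))
  · exfalso
    obtain ⟨v, s, t, hs, hst, ht⟩ := exists_separating_vector (convex_convexCombinations hconv)
      (isCompact_convexCombinations hcomp) (PointedCone.convex H).closure.neg
      isClosed_closure.neg hdisj
    have hH : ∀ c ∈ H, c v < -t := fun c hc => by
      have := ht (-c) (by simpa using subset_closure hc)
      have h2 : (-c) v = -(c v) := rfl
      linarith
    have ht0 : t < 0 := by
      have h0 : (0 : WeakDual ℝ X) v = 0 := rfl
      linarith [hH 0 H.zero_mem]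
    refine h v (fun i a ha => ?_) fun c hc => ?_
    · linarith [hs a (single_mem_convexCombinations hne ha)]
    · by_contra! hcv
      -- This scaling makes the value at `v` exactly `-t`, contradicting the strict bound on the
      -- cone.
      have hmem : (-t / c v) • c ∈ H :=
        PointedCone.smul_mem H (div_nonneg (by linarith) hcv.le) (Submodule.subset_span hc)
      have h1 := hH _ hmem
      have h2 : ((-t / c v) • c) v = -t / c v * c v := rfl
      rw [h2, div_mul_cancel₀ _ hcv.ne'] at h1
      exact lt_irrefl _ h1
  · obtain ⟨_, ⟨⟨μ, a⟩, ⟨hμ, ha⟩, rfl⟩, hc⟩ := not_disjoint_iff.1 hdisj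
    exact ⟨μ, hμ, a, fun i => ha i trivial, _, hc, add_neg_cancel _⟩

/-- The half-space cut out by evaluation at `v` is a weak* closed convex cone. -/
lemma apply_nonpos_of_mem_closure_hull {C : Set (WeakDual ℝ X)} {v : X}
    (h : ∀ c ∈ C, c v ≤ 0) {c : WeakDual ℝ X}
    (hc : c ∈ closure (PointedCone.hull ℝ C : Set (WeakDual ℝ X))) : c v ≤ 0 := by
  refine closure_minimal (t := {c : WeakDual ℝ X | c v ≤ 0}) (fun c hc => ?_)
    (isClosed_le (WeakDual.eval_continuous v) continuous_const) hc
  induction hc using Submodule.span_induction with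
  | mem x hx => exact h x hx
  | zero => exact le_refl (0 : ℝ)
  | add x y _ _ hx hy => exact add_nonpos (a := x v) (b := y v) hx hy
  | smul a x _ hx => exact mul_nonpos_of_nonneg_of_nonpos (a := (a : ℝ)) (b := x v) a.2 hx

lemma smul_mem_closure_hull {C : Set (WeakDual ℝ X)} {r : ℝ} (hr : 0 ≤ r) {c : WeakDual ℝ X}
    (hc : c ∈ closure (PointedCone.hull ℝ C : Set (WeakDual ℝ X))) :
    r • c ∈ closure (PointedCone.hull ℝ C : Set (WeakDual ℝ X)) :=
  map_mem_closure (continuous_const_smul r) hc fun _ hx =>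
    PointedCone.smul_mem _ hr hx

end Separation

end Quasidiff

/-! ### The multiplier rule. -/

theorem mainTheorem2 {X : Type*} [NormedAddCommGroup X] [NormedSpace ℝ X] [CompleteSpace X]
    {m l : ℕ} (f₀ : X → ℝ) (f : Fin m → X → ℝ) (g : Fin l → X → ℝ) (xbar : X)
    -- the given quasidifferentials `[A₀, B₀]`, `[Af i, Bf i]`, `[Ag j, Bg j]` at `xbar`
    (A₀ B₀ : Set (WeakDual ℝ X)) (Af Bf : Fin m → Set (WeakDual ℝ X))
    (Ag Bg : Fin l → Set (WeakDual ℝ X))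
    (hopt : Quasidiff.IsLocallyOptimal f₀ f g xbar)
    (hf₀_qd : Quasidiff.IsQuasidifferentialAt f₀ xbar A₀ B₀)
    (hf₀_had : Quasidiff.HadamardDirDiffAt f₀ xbar)
    (hf_cont : ∀ i, ∃ U ∈ 𝓝 xbar, ContinuousOn (f i) U)
    (hf_qd : ∀ i, Quasidiff.IsQuasidifferentialAt (f i) xbar (Af i) (Bf i))
    (hf_unif : ∀ i, Quasidiff.DirDiffUniformlyFinDimAt (f i) xbar)
    (hg_usc : ∀ j, j ∉ Quasidiff.activeSet g xbar → UpperSemicontinuousAt (g j) xbar)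
    (hg_qd : ∀ j, Quasidiff.IsQuasidifferentialAt (g j) xbar (Ag j) (Bg j))
    (hg_unif : ∀ j ∈ Quasidiff.activeSet g xbar, Quasidiff.DirDiffUniformlyFinDimAt (g j) xbar)
    (xs ys : Fin m → WeakDual ℝ X) (zs : Fin l → WeakDual ℝ X)
    (hxs : ∀ i, xs i ∈ Af i) (hys : ∀ i, ys i ∈ Bf i)
    (hzs : ∀ j ∈ Quasidiff.activeSet g xbar, zs j ∈ Bg j)
    (hCQ : Quasidiff.ConstraintQualification Af Bf xs ys Ag zs (Quasidiff.activeSet g xbar)) :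
    ∀ y₀ ∈ B₀, ∀ z : Fin l → WeakDual ℝ X,
      (∀ j ∈ Quasidiff.activeSet g xbar, z j = zs j) →
      (∀ j, j ∉ Quasidiff.activeSet g xbar → z j ∈ Bg j) →
      ∃ lam : Fin l → ℝ, (∀ j, 0 ≤ lam j) ∧ (∀ j, lam j * g j xbar = 0) ∧
        (0 : WeakDual ℝ X) ∈ A₀ + {y₀} + (∑ j, lam j • (Ag j + {z j})) +
          closure (PointedCone.hull ℝ
            (⋃ i, ((Af i + {ys i}) ∪ ({-xs i} - Bf i))) : Set (WeakDual ℝ X)) := by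
  classical
  intro y₀ hy₀ z hz _
  set act := Quasidiff.activeSet g xbar with hact
  set C : Set (WeakDual ℝ X) := ⋃ i, ((Af i + {ys i}) ∪ ({-xs i} - Bf i)) with hC
  have hmemA : ∀ i, ∀ a ∈ Af i, a + ys i ∈ C := fun i a ha =>
    mem_iUnion.2 ⟨i, Or.inl (add_mem_add ha rfl)⟩
  have hmemB : ∀ i, ∀ b ∈ Bf i, -xs i - b ∈ C := fun i b hb =>
    mem_iUnion.2 ⟨i, Or.inr (sub_mem_sub (mem_singleton _) hb)⟩
  obtain ⟨v₀, hv₀, hv₀'⟩ := hCQ.ineq_dir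
  let S : Option act → Set (WeakDual ℝ X) :=
    fun o => o.elim (A₀ + {y₀}) fun j => Ag j + {zs j}
  obtain ⟨μ, hμ, s, hs, c, hc, hsum⟩ := Quasidiff.exists_combination_add_mem_closure_hull (S := S)
    (fun o => by
      cases o with
      | none => exact hf₀_qd.convex_sub.add (convex_singleton _)
      | some j => exact (hg_qd j).convex_sub.add (convex_singleton _))
    (fun o => by
      cases o with
      | none => exact hf₀_qd.isCompact_sub.add isCompact_singleton
      | some j => exact (hg_qd j).isCompact_sub.add isCompact_singleton)
    (fun o => by
      cases o with
      | none => exact hf₀_qd.nonempty_sub.add (singleton_nonempty _)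
      | some j => exact (hg_qd j).nonempty_sub.add (singleton_nonempty _)) C
    fun v hvS hvC => Quasidiff.not_descent_direction hopt hf₀_qd hf₀_had hf_cont hf_qd hf_unif
      hg_usc hg_qd hg_unif hxs hys hzs hCQ hy₀
      (fun a ha => hvS none (a + y₀) (add_mem_add ha rfl))
      (fun j hj a ha => hvS (some ⟨j, hj⟩) (a + zs j) (add_mem_add ha rfl))
      (fun k a ha => hvC _ (hmemA k a ha)) fun k b hb => hvC _ (hmemB k b hb)
  have hv₀C : ∀ c ∈ C, c v₀ ≤ 0 := by
    intro c hc
    obtain ⟨i, hi⟩ := mem_iUnion.1 hc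
    rcases hi with ⟨a, ha, _, rfl, rfl⟩ | ⟨_, rfl, b, hb, rfl⟩
    · exact (Quasidiff.add_apply_le_supportFun (hf_qd i).isCompact_sub ha (ys i) v₀).trans
        (hv₀' i).1
    · exact (Quasidiff.neg_sub_apply_le_supportFun (hf_qd i).isCompact_super hb (xs i) v₀).trans
        (hv₀' i).2
  rw [Fintype.sum_option] at hsum
  have hμ1 := hμ.2
  rw [Fintype.sum_option] at hμ1
  -- If the objective's weight were zero, evaluation at `v₀` would make a sum of nonpositive terms
  -- vanish. Strict negativity on active constraints would then kill every weight, although the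
  -- weights sum to `1`.
  have hμ0 : 0 < μ none := by
    refine lt_of_le_of_ne (hμ.1 none) fun h0 => ?_
    rw [← h0, zero_smul, zero_add] at hsum
    rw [← h0, zero_add] at hμ1
    have hsv : ∀ j : act, s (some j) v₀ < 0 := fun j => by
      obtain ⟨a, ha, _, rfl, haj⟩ := hs (some j)
      rw [← haj]
      exact (Quasidiff.add_apply_le_supportFun (hg_qd j).isCompact_sub ha (zs j) v₀).trans_lt
        (hv₀ j j.2)
    have hev : (∑ j, μ (some j) * s (some j) v₀) + c v₀ = 0 := by
      have := DFunLike.congr_fun hsum v₀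
      have hlin : (∑ j, μ (some j) • s (some j)) v₀ = ∑ j, μ (some j) * s (some j) v₀ :=
        map_sum (WeakBilin.eval (topDualPairing ℝ X) v₀) _ _
      rw [← hlin]
      exact this
    have hle := Quasidiff.apply_nonpos_of_mem_closure_hull hv₀C hc
    have hterm : ∀ j : act, μ (some j) * s (some j) v₀ ≤ 0 := fun j =>
      mul_nonpos_of_nonneg_of_nonpos (hμ.1 _) (hsv j).le
    have hzero := (Finset.sum_eq_zero_iff_of_nonpos fun j _ => hterm j).1
      (le_antisymm (Finset.sum_nonpos fun j _ => hterm j) (by linarith))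
    have : ∀ j : act, μ (some j) = 0 := fun j =>
      (mul_eq_zero.1 (hzero j (Finset.mem_univ _))).resolve_right (hsv j).ne
    simp [this] at hμ1
  refine ⟨fun j => if hj : j ∈ act then (μ none)⁻¹ * μ (some ⟨j, hj⟩) else 0, fun j => ?_,
    fun j => ?_, ?_⟩
  · dsimp only
    split_ifs
    · exact mul_nonneg (inv_nonneg.2 hμ0.le) (hμ.1 _)
    · exact le_rfl
  · dsimp only
    split_ifs with hj
    · rw [show g j xbar = 0 from hj, mul_zero]
    · exact zero_mul _
  · have hkey : s none + (∑ j : act, ((μ none)⁻¹ * μ (some j)) • s (some j)) + (μ none)⁻¹ • c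
        = 0 := by
      have := congrArg (fun w => (μ none)⁻¹ • w) hsum
      simpa only [smul_add, smul_smul, inv_mul_cancel₀ hμ0.ne', one_smul, smul_zero,
        Finset.smul_sum] using this
    rw [← hkey]
    refine add_mem_add (add_mem_add (hs none) ?_)
      (Quasidiff.smul_mem_closure_hull (inv_nonneg.2 hμ0.le) hc)
    have hext : ∑ j : act, ((μ none)⁻¹ * μ (some j)) • s (some j) =
        ∑ j, if hj : j ∈ act then ((μ none)⁻¹ * μ (some ⟨j, hj⟩)) • s (some ⟨j, hj⟩) else 0 := by
      refine Fintype.sum_of_injective Subtype.val Subtype.val_injective _ _ (fun j hj => ?_)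
        fun j => by simp
      exact dif_neg fun h => hj ⟨⟨j, h⟩, rfl⟩
    rw [hext]
    refine finsetSum_mem_finsetSum _ _ _ fun j _ => ?_
    by_cases hj : j ∈ act
    · simp only [hj, dif_pos]
      rw [hz j hj]
      exact smul_mem_smul_set (hs (some ⟨j, hj⟩))
    · simp only [hj, dif_neg, not_false_eq_true]
      -- The multiplier is zero here, but `0 • ∅` is empty, so nonemptiness is needed to obtain the
      -- summand `0`.
      obtain ⟨a, ha⟩ := (hg_qd j).nonempty_sub
      exact ⟨a + z j, add_mem_add ha rfl, zero_smul _ _⟩
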